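/- **Conventions.** Let $G=(V,E)$ be a finite strongly connected digraph ($E\subseteq V\times V$). Vertices $v,w$ are *2-edge-connected* in $G$ if they are in the same strongly connected component and remain in the same strongly connected component after the removal of any single edge. A *2-edge-connected block* of $G$ is a maximal set $B\subseteq V$ of pairwise 2-edge-connected vertices. Fix $s\in V$. A vertex $u$ *dominates* $w$ if every path from $s$ to $w$ contains $u$. The *dominator tree* $D(s)$ is rooted at $s$, and the parent $d(w)$ of $w\neq s$ is the proper dominator of $w$ that is dominated by all proper dominators of $w$. An edge $(u,w)\in E$ is a *bridge* of $G(s)$ if all paths from $s$ to $w$ contain it; then $w$ is called *marked*. Removing the edges $(d(w),w)$ with $w$ marked decomposes $D(s)$ into trees; $T(r)$ is the tree with root $r$, where $r=s$ or $r$ is marked. For a root $r$ the *auxiliary graph* $G_r$ has as *ordinary* vertices those of $T(r)$, and as auxiliary vertices the marked children in $D(s)$ of vertices of $T(r)$ and, if $r\ne s$, the vertex $d(r)$. Its edges are (without multiplicity): - the edges of $G$ between ordinary vertices; - $(w,z)$ for each marked child $z$ of a $w\in T(r)$; - $(d(r),r)$ if $r\neq s$; - for each $(u,v)\in E$ with $u\in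 T(r)$ and $v$ not a descendant of $r$ in $D(s)$, the edge $(u,d(r))$; - for each $(u,v)\in E$ such that $u$ is a (not necessarily proper) descendant of a marked child $z$ of a vertex of $T(r)$: the edge $(z,v)$ if $v\in T(r)$, and the edge $(z,d(r))$ if $v$ is not a descendant of $r$. **Algorithm Fast2ECB**$(G,s)$. Compute $D(s)$ and the bridges of $G(s)$. For each root $r$ that is a leaf of $D(s)$, output the block $T(r)=\{r\}$. For each other root $r$, let $H=G_r$, let $H^R$ be its reverse, and compute the dominator tree $D_H^R(r)$ of $H^R$ with start vertex $r$, the bridges of $H^R(r)$, and the resulting trees $T_H^R(q)$. For each root $q$ that is a leaf of $D_H^R(r)$, output $\{q\}$ if $q\in T(r)$. For each other root $q$, construct the auxiliary graph $H^R_q$ of $H^R(r)$, delete from it the edge $(d_H^R(q),q)$ (nothing is deleted if $q=r$), and output, for each strongly connected component $S$ of the resulting digraph, the set $S\cap T_H^R(q)\cap T(r)$ if it is nonempty. **Lemma (correctness of Fast2ECB).** For every finite strongly connected digraph $G$ and every choice of the start vertex $s\in V$, the family of sets output by Fast2ECB$(G,s)$ is exactly the family of 2-edge-connected blocks of $G$.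 -/

import Mathlib

namespace TwoECB

variable {V : Type*}

/-! ### Paths, strong connectivity and 2-edge-connected blocks -/

/-- The list of vertices `p` is a (directed, not necessarily simple) path from `v` to `w`. -/
def IsPath (G : Digraph V) (v w : V) (p : List V) : Prop :=
  p.IsChain G.Adj ∧ p.head? = some v ∧ p.getLast? = some w

/-- The path `p` contains the edge `(x, y)`. -/
def HasEdge (p : List V) (x y : V) : Prop := [x, y] <:+: p

/-- There is a path from `v` to `w`. -/
def Reaches (G : Digraph V) (v w : V) : Prop := ∃ p, IsPath G v w p

def StronglyConnected (G : Digraph V) : Prop := ∀ v w, Reaches G v w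

/-- `v` and `w` lie in the same strongly connected component. -/
def SameSCC (G : Digraph V) (v w : V) : Prop := Reaches G v w ∧ Reaches G w v

/-- The vertex sets of the strongly connected components. -/
def sccs (G : Digraph V) : Set (Set V) := {S | ∃ v, S = {w | SameSCC G v w}}

/-- `G \ (x, y)` : the digraph without the edge `(x, y)`. -/
def deleteEdge (G : Digraph V) (x y : V) : Digraph V where
  Adj a b := G.Adj a b ∧ ¬ (a = x ∧ b = y)

/-- The reverse digraph. -/
def reverse (G : Digraph V) : Digraph V where
  Adj a b := G.Adj b a

/-- `v` and `w` are in the same strongly connected component, and the removal of any edge leaves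
them in the same strongly connected component. -/
def TwoEdgeConnected (G : Digraph V) (v w : V) : Prop :=
  SameSCC G v w ∧ ∀ x y, G.Adj x y → SameSCC (deleteEdge G x y) v w

/-- A maximal set of pairwise 2-edge-connected vertices. -/
def IsTwoEdgeConnectedBlock (G : Digraph V) (B : Set V) : Prop :=
  Maximal (fun B : Set V => ∀ u ∈ B, ∀ w ∈ B, TwoEdgeConnected G u w) B

/-! ### Dominators and bridges of the flow graph `G(s)` -/

/-- `u` dominates `w` in `G(s)`: every path from `s` to `w` contains `u`. -/
def Dominates (G : Digraph V) (s u w : V) : Prop := ∀ p, IsPath G s w p → u ∈ p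

def ProperlyDominates (G : Digraph V) (s u w : V) : Prop := Dominates G s u w ∧ u ≠ w

/-- `u = d(w)`: `u` is a proper dominator of `w` that is dominated by all proper dominators
of `w`. -/
def IsIdom (G : Digraph V) (s u w : V) : Prop :=
  ProperlyDominates G s u w ∧ ∀ x, ProperlyDominates G s x w → Dominates G s x u

/-- The dominator tree `D(s)`, with edges `(d(w), w)` directed from parent to child. -/
def domTree (G : Digraph V) (s : V) : Digraph V where
  Adj u w := IsIdom G s u w

/-- `w` is a (not necessarily proper) descendant of `u` in `D(s)`. -/
def Descendant (G : Digraph V) (s u w : V) : Prop := Reaches (domTree G s) u w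

/-- `u` is a leaf of `D(s)`. -/
def IsLeaf (G : Digraph V) (s u : V) : Prop := ∀ w, ¬ (domTree G s).Adj u w

/-- The edge `(u, w)` is a bridge of `G(s)`: all paths from `s` to `w` contain it. -/
def IsBridge (G : Digraph V) (s u w : V) : Prop :=
  G.Adj u w ∧ ∀ p, IsPath G s w p → HasEdge p u w

/-- A vertex is marked if a bridge of `G(s)` enters it. -/
def Marked (G : Digraph V) (s w : V) : Prop := ∃ u, IsBridge G s u w

/-! ### Decomposition of the dominator tree -/

/-- The forest obtained from `D(s)` by removing all edges `(d(w), w)` with `w` marked. -/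
def domForest (G : Digraph V) (s : V) : Digraph V where
  Adj u w := (domTree G s).Adj u w ∧ ¬ Marked G s w

/-- The roots of the trees of the forest: the start vertex and the marked vertices. -/
def IsRoot (G : Digraph V) (s r : V) : Prop := r = s ∨ Marked G s r

/-- The vertex set of the tree `T(r)` of the forest with root `r`. -/
def subtree (G : Digraph V) (s r : V) : Set V := {v | Reaches (domForest G s) r v}

theorem mem_subtree_self (G : Digraph V) (s r : V) : r ∈ subtree G s r :=
  ⟨[r], by simp [IsPath]⟩

/-! ### Auxiliary graphs -/

/-- `z` is a marked child in `D(s)` of `w`, where `w` is a vertex of `T(r)`; thus `w` is a boundary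
vertex in `T(r)`. -/
def MarkedChild (G : Digraph V) (s r w z : V) : Prop :=
  w ∈ subtree G s r ∧ (domTree G s).Adj w z ∧ Marked G s z

/-- The vertex set `V_r`: the ordinary vertices, which are those of `T(r)`, and the auxiliary
vertices, which are the marked children of boundary vertices in `T(r)` and `d(r)` (if `r ≠ s`).
All these vertices are distinct vertices of `G`, so a copy of a vertex is represented by the vertex
itself. -/
def auxVerts (G : Digraph V) (s r : V) : Set V :=
  {v | v ∈ subtree G s r ∨ (∃ w, MarkedChild G s r w v) ∨ (domTree G s).Adj v r}

/-- The edges of the auxiliary graph `G_r`. A vertex `b` with `(domTree G s).Adj b r` is `d(r)`. -/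
inductive AuxAdj (G : Digraph V) (s r : V) : V → V → Prop
  /-- edges of `G` induced by the ordinary vertices -/
  | ordinary {a b : V} (ha : a ∈ subtree G s r) (hb : b ∈ subtree G s r) (h : G.Adj a b) :
      AuxAdj G s r a b
  /-- the edge from a boundary vertex `w` to a marked child `z` of `w` -/
  | leave {w z : V} (hz : MarkedChild G s r w z) : AuxAdj G s r w z
  /-- the edge `(d(r), r)` -/
  | enter {b : V} (hb : (domTree G s).Adj b r) : AuxAdj G s r b r
  /-- shortcut `(u, d(r))` of an edge `(u, v)` with `u` ordinary and `v` not a descendant of `r` -/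
  | shortcutA {u v b : V} (h : G.Adj u v) (hu : u ∈ subtree G s r) (hv : ¬ Descendant G s r v)
      (hb : (domTree G s).Adj b r) : AuxAdj G s r u b
  /-- shortcut `(z, v)` of an edge `(u, v)` with `v` ordinary and `u` a proper descendant of a
  boundary vertex `w`, where `z` is the (marked) child of `w` that is an ancestor of `u` -/
  | shortcutB {u v w z : V} (h : G.Adj u v) (hv : v ∈ subtree G s r)
      (hz : MarkedChild G s r w z) (hu : Descendant G s z u) : AuxAdj G s r z v
  /-- shortcut `(z, d(r))` of an edge `(u, v)` with `v` not a descendant of `r` and `u` a proper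
  descendant of a boundary vertex `w`, where `z` is the (marked) child of `w` that is an ancestor
  of `u` -/
  | shortcutC {u v w z b : V} (h : G.Adj u v) (hv : ¬ Descendant G s r v)
      (hz : MarkedChild G s r w z) (hu : Descendant G s z u) (hb : (domTree G s).Adj b r) :
      AuxAdj G s r z b

/-- The auxiliary graph `G_r` of `G(s)`. -/
def auxGraph (G : Digraph V) (s r : V) : Digraph (auxVerts G s r) where
  Adj a b := AuxAdj G s r a b

/-- The vertex `r` of `G_r`. -/
def auxRoot (G : Digraph V) (s r : V) : auxVerts G s r := ⟨r, Or.inl (mem_subtree_self G s r)⟩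

/-- `G_r \ (d(r), r)`; this is `G_r` if `r` is the start vertex, where no `d(r)` exists. -/
def auxGraphDel (G : Digraph V) (s r : V) : Digraph (auxVerts G s r) where
  Adj a b := (auxGraph G s r).Adj a b ∧ ¬ ((domTree G s).Adj a r ∧ b = auxRoot G s r)

/-! ### The algorithm -/

/-- The sets of vertices of `G(s)` found for the root `r` in the last phase: the sets of ordinary
vertices of `G_r` in the strongly connected components of `G_r \ (d(r), r)`. No auxiliary graph is
built if `r` is a leaf of `D(s)`; then `T(r) = {r}` is the only such set. -/
def sccPieces (G : Digraph V) (s r : V) : Set (Set V) :=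
  {B | (IsLeaf G s r ∧ B = {r}) ∨
    (¬ IsLeaf G s r ∧ ∃ S ∈ sccs (auxGraphDel G s r), B = Subtype.val '' S ∩ subtree G s r)}

/-- The processing of an auxiliary graph `H` with root `r` and set `O` of ordinary vertices: for
every tree `T_H^R(q)` in the decomposition of the dominator tree of `H^R(r)`, the vertices of `O` in
`T_H^R(q)` are partitioned according to the strongly connected components of
`H^R_q \ (d_H^R(q), q)`. -/
def processAux (H : Digraph V) (r : V) (O : Set V) : Set (Set V) :=
  {B | B.Nonempty ∧ ∃ q, IsRoot (reverse H) r q ∧ ∃ C ∈ sccPieces (reverse H) r q, B = C ∩ O}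

/-- The family of vertex sets that Algorithm Fast2ECB outputs on the strongly connected digraph `G`
with start vertex `s`: for every tree `T(r)` in the decomposition of `D(s)`, the blocks obtained by
processing `H = G_r`, or the single block `T(r) = {r}` if `r` is a leaf of `D(s)`. -/
def fast2ECB (G : Digraph V) (s : V) : Set (Set V) :=
  {B | ∃ r, IsRoot G s r ∧
    ((IsLeaf G s r ∧ B = {r}) ∨
      (¬ IsLeaf G s r ∧ ∃ C ∈ processAux (auxGraph G s r) (auxRoot G s r)
        {x | (x : V) ∈ subtree G s r}, B = Subtype.val '' C))}

end TwoECB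

namespace TwoECB

open Relation

/-! ### Paths as reflexive transitive closures -/

section Paths

variable {V : Type*}

/-! Two-edge-connectivity is an equivalence relation whose classes are the blocks, so it suffices
that each output set is a class and each class is output. A bridge is the only edge entering the set
of vertices dominated by its head, so a class never straddles two trees $T(r)$
(`TwoEdgeConnected.mem_subtree`).

The graph $G_r$ is a contraction of $G$: ordinary vertices stay, the descendants of a marked child
$z$ collapse to $z$, and the non-descendants of $r$ collapse to $d(r)$. Each collapsed class has a
gate, a bridge through which every visit between ordinary vertices passes. Deleting the gate makes
the whole class useless, so it is at least as harmful as deleting any edge at or inside the class.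
Hence $G$ and $G_r$ agree on two-edge-connectivity of ordinary vertices
(`twoEdgeConnected_auxGraph_iff`).

No single deletion cuts $r$ off from a vertex of $T(r)$, and $G_r$ inherits this. In the reverse of
$G_r$ every ordinary vertex therefore still reaches the start vertex $r$ after any deletion. With
this robustness, one test per tree with root $q$ is enough (`sameSCC_auxGraphDel_iff`): a deletion
either leaves the target reachable through the start vertex, or removes a bridge whose head
dominates $q$, and such a deletion is no worse than deleting $(d(q),q)$. -/

theorem exists_chain_iff_reflTransGen {R : V → V → Prop} {v w : V} :
    (∃ p : List V, p.IsChain R ∧ p.head? = some v ∧ p.getLast? = some w) ↔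
      ReflTransGen R v w := by
  constructor
  · rintro ⟨p, hc, hv, hw⟩
    induction p generalizing v with
    | nil => simp at hv
    | cons a l ih =>
      obtain rfl : a = v := by simpa using hv
      cases l with
      | nil =>
        obtain rfl : a = w := by simpa using hw
        exact .refl
      | cons b l =>
        rw [List.isChain_cons_cons] at hc
        exact .head hc.1 (ih hc.2 rfl (by simpa using hw))
  · intro h
    induction h using ReflTransGen.head_induction_on with
    | refl => exact ⟨[w], by simp⟩
    | @head a b hab _ ih =>
      obtain ⟨p, hc, hv, hw⟩ := ih
      cases p with
      | nil => simp at hv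
      | cons c l =>
        obtain rfl : c = b := by simpa using hv
        exact ⟨a :: c :: l, List.isChain_cons_cons.2 ⟨hab, hc⟩, rfl, by simpa using hw⟩

theorem reflTransGen_of_le {R S : V → V → Prop} {v w : V} (h : ReflTransGen R v w)
    (hRS : ∀ a b, R a b → S a b) : ReflTransGen S v w :=
  ReflTransGen.lift id hRS _ _ h

theorem reaches_iff {G : Digraph V} {v w : V} : Reaches G v w ↔ ReflTransGen G.Adj v w :=
  exists_chain_iff_reflTransGen

theorem isChain_and_not_hasEdge {R : V → V → Prop} {x y : V} {p : List V} :
    (p.IsChain R ∧ ¬ HasEdge p x y) ↔ p.IsChain fun a b => R a b ∧ ¬ (a = x ∧ b = y) := by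
  unfold HasEdge
  induction p with
  | nil => simp
  | cons a l ih =>
    cases l with
    | nil => simp [List.infix_cons_iff]
    | cons b l =>
      rw [List.isChain_cons_cons, List.isChain_cons_cons, ← ih, List.infix_cons_iff]
      simp only [List.cons_prefix_cons, List.nil_prefix, and_true]
      grind

/-- Only heads of edges are tested on the right, so the first vertex needs its own hypothesis. -/
theorem isChain_and_not_mem {R : V → V → Prop} {u : V} {p : List V} (hp : p.head? ≠ some u) :
    (p.IsChain R ∧ u ∉ p) ↔ p.IsChain fun a b => R a b ∧ b ≠ u := by
  induction p with
  | nil => simp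
  | cons a l ih =>
    have ha : a ≠ u := by simpa using hp
    cases l with
    | nil => simpa using ha.symm
    | cons b l =>
      rw [List.isChain_cons_cons, List.isChain_cons_cons]
      by_cases hb : b = u
      · simp [hb]
      · rw [← ih (by simpa using hb)]
        simp only [List.mem_cons]
        grind

/-- A path that starts and ends outside `C` stays outside `C` if no edge enters `C`, or if no edge
leaves `C`. -/
theorem reflTransGen_confine {R : V → V → Prop} {C : Set V} {x y : V} (h : ReflTransGen R x y)
    (hx : x ∉ C) (hy : y ∉ C)
    (hC : (∀ a b, R a b → b ∈ C → a ∈ C) ∨ (∀ a b, R a b → a ∈ C → b ∈ C)) :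
    ReflTransGen (fun a b => R a b ∧ a ∉ C ∧ b ∉ C) x y := by
  rcases hC with hC | hC
  · suffices y ∉ C ∧ ReflTransGen (fun a b => R a b ∧ a ∉ C ∧ b ∉ C) x y from this.2
    clear hy
    induction h with
    | refl => exact ⟨hx, .refl⟩
    | tail _ hab ih =>
      have hb := fun hb => ih.1 (hC _ _ hab hb)
      exact ⟨hb, ih.2.tail ⟨hab, ih.1, hb⟩⟩
  · suffices x ∉ C ∧ ReflTransGen (fun a b => R a b ∧ a ∉ C ∧ b ∉ C) x y from this.2
    clear hx
    induction h using ReflTransGen.head_induction_on with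
    | refl => exact ⟨hy, .refl⟩
    | head hab _ ih =>
      have ha := fun ha => ih.1 (hC _ _ hab ha)
      exact ⟨ha, .head ⟨hab, ha, ih.1⟩ ih.2⟩

end Paths

/-! ### Dominators -/

section Dominators

variable {V : Type*} {G : Digraph V} {s u v w : V}

/-- There is a path from `s` to `w` that avoids `u`. -/
def ReachesAvoiding (G : Digraph V) (s u w : V) : Prop :=
  s ≠ u ∧ ReflTransGen (fun a b => G.Adj a b ∧ b ≠ u) s w

theorem not_dominates_iff : ¬ Dominates G s u w ↔ ReachesAvoiding G s u w := by
  unfold Dominates ReachesAvoiding IsPath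
  rw [← exists_chain_iff_reflTransGen]
  push Not
  constructor
  · rintro ⟨p, ⟨hc, hs, hw⟩, hu⟩
    have hsu : s ≠ u := by
      rintro rfl
      exact hu (List.mem_of_mem_head? hs)
    exact ⟨hsu, p, (isChain_and_not_mem (by simpa [hs] using hsu)).1 ⟨hc, hu⟩, hs, hw⟩
  · rintro ⟨hsu, p, hc, hs, hw⟩
    obtain ⟨hc, hu⟩ := (isChain_and_not_mem (by simpa [hs] using hsu)).2 hc
    exact ⟨p, ⟨hc, hs, hw⟩, hu⟩

theorem dominates_iff : Dominates G s u w ↔ ¬ ReachesAvoiding G s u w := by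
  rw [← not_dominates_iff, not_not]

theorem ReachesAvoiding.ne (h : ReachesAvoiding G s u w) : w ≠ u := by
  rcases h with ⟨h, h'⟩
  cases h' with
  | refl => exact h
  | tail _ h' => exact h'.2

theorem ReachesAvoiding.tail (h : ReachesAvoiding G s u v) (hvw : G.Adj v w) (hw : w ≠ u) :
    ReachesAvoiding G s u w :=
  ⟨h.1, h.2.tail ⟨hvw, hw⟩⟩

theorem dominates_refl (G : Digraph V) (s u : V) : Dominates G s u u :=
  dominates_iff.2 fun h => h.ne rfl

theorem dominates_start (G : Digraph V) (s u : V) : Dominates G s s u :=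
  dominates_iff.2 fun h => h.1 rfl

/-- Follow a path to `w` that avoids `u`: either it misses `v`, or its part up to `v` avoids `u`. -/
theorem Dominates.trans (huv : Dominates G s u v) (hvw : Dominates G s v w) :
    Dominates G s u w := by
  rw [dominates_iff] at *
  rintro ⟨hsu, h⟩
  have : ReachesAvoiding G s v w ∨ ReachesAvoiding G s u v := by
    clear hvw
    induction h with
    | refl =>
      by_cases hsv : s = v
      · exact .inr ⟨hsu, hsv ▸ .refl⟩
      · exact .inl ⟨hsv, .refl⟩
    | @tail b c hb hbc ih =>
      rcases ih with ih | ih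
      · by_cases hcv : c = v
        · exact .inr ⟨hsu, hcv ▸ hb.tail hbc⟩
        · exact .inl (ih.tail hbc.1 hcv)
      · exact .inr ih
  exact this.elim hvw huv

/-- If `u ≠ v`, the first of the two met by a path from `s` would be reached without the other; so
no path meets either of them. -/
theorem Dominates.antisymm (hG : StronglyConnected G) (huv : Dominates G s u v)
    (hvu : Dominates G s v u) : u = v := by
  rw [dominates_iff] at *
  by_contra hne
  have key : ∀ t, ReflTransGen G.Adj s t → ReachesAvoiding G s u t ∧ ReachesAvoiding G s v t := by
    intro t ht
    induction ht with
    | refl =>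
      exact ⟨⟨fun h => hvu ⟨h ▸ hne, h ▸ .refl⟩, .refl⟩,
        ⟨fun h => huv ⟨h ▸ Ne.symm hne, h ▸ .refl⟩, .refl⟩⟩
    | @tail b c _ hbc ih =>
      have hcu : c ≠ u := fun h => hvu (h ▸ ih.2.tail hbc (h ▸ hne))
      have hcv : c ≠ v := fun h => huv (h ▸ ih.1.tail hbc (h ▸ Ne.symm hne))
      exact ⟨ih.1.tail hbc hcu, ih.2.tail hbc hcv⟩
  exact huv (key v (reaches_iff.1 (hG s v))).1

/-- If neither dominates the other, a path to `w` that hits `u` can be exchanged for one reaching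
`u` without `v`, and conversely; this keeps one of the two avoided all the way to `w`. -/
theorem Dominates.total (hG : StronglyConnected G) (hu : Dominates G s u w)
    (hv : Dominates G s v w) : Dominates G s u v ∨ Dominates G s v u := by
  by_contra! h
  rw [not_dominates_iff, not_dominates_iff] at h
  rw [dominates_iff] at hu hv
  have key : ∀ t, ReflTransGen G.Adj s t → ReachesAvoiding G s u t ∨ ReachesAvoiding G s v t := by
    intro t ht
    induction ht with
    | refl => exact .inl ⟨h.1.1, .refl⟩
    | @tail b c _ hbc ih =>
      rcases ih with ih | ih
      · by_cases hc : c = u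
        · exact .inr (hc ▸ h.2)
        · exact .inl (ih.tail hbc hc)
      · by_cases hc : c = v
        · exact .inl (hc ▸ h.1)
        · exact .inr (ih.tail hbc hc)
  exact (key w (reaches_iff.1 (hG s w))).elim hu hv

/-- An edge entering the set of vertices dominated by `u` enters `u`. -/
theorem Dominates.eq_of_adj (h : G.Adj v w) (hw : Dominates G s u w) (hv : ¬ Dominates G s u v) :
    w = u := by
  by_contra hne
  exact dominates_iff.1 hw ((not_dominates_iff.1 hv).tail h hne)

/-- A path from `s` to a vertex dominated by `r` contains a final part starting in `r` that does
not return to `r`. -/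
theorem Dominates.reflTransGen_from {R : V → V → Prop} (hR : ∀ a b, R a b → G.Adj a b) {r : V}
    (h : ReflTransGen R s w) (hw : Dominates G s r w) :
    ReflTransGen (fun a b => R a b ∧ b ≠ r ∧ Dominates G s r a ∧ Dominates G s r b) r w := by
  have key : ReachesAvoiding G s r w ∨ ReflTransGen (fun a b => R a b ∧ b ≠ r) r w := by
    clear hw
    induction h with
    | refl =>
      by_cases hs : s = r
      · exact .inr (hs ▸ .refl)
      · exact .inl ⟨hs, .refl⟩
    | @tail b c _ hbc ih =>
      by_cases hc : c = r
      · exact .inr (hc ▸ .refl)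
      · exact ih.imp (fun h => h.tail (hR _ _ hbc) hc) (fun h => h.tail ⟨hbc, hc⟩)
  have key := key.resolve_left (dominates_iff.1 hw)
  -- A path that left the vertices dominated by `r` could come back only through `r`, which `key`
  -- excludes.
  refine reflTransGen_of_le (reflTransGen_confine (C := {t | ¬ Dominates G s r t}) key
    (by simp [dominates_refl]) (by simpa using hw) (.inr ?_)) ?_
  · intro a b hab ha hb
    exact hab.2 (Dominates.eq_of_adj (hR _ _ hab.1) hb ha)
  · intro a b h
    simp only [Set.mem_ofPred_eq, not_not] at h
    exact ⟨h.1.1, h.1.2, h.2.1, h.2.2⟩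

theorem IsIdom.unique (hG : StronglyConnected G) (hu : IsIdom G s u w) (hv : IsIdom G s v w) :
    u = v :=
  (hv.2 u hu.1).antisymm hG (hu.2 v hv.1)

variable [Finite V]

/-- The dominators of `w` form a chain, so a proper dominator with the most dominators is the lowest
one. -/
theorem exists_isIdom (hG : StronglyConnected G) (hw : w ≠ s) : ∃ u, IsIdom G s u w := by
  obtain ⟨u, hu, hmax⟩ := Set.Finite.exists_maximalFor
    (fun u => {x | Dominates G s x u}) {u | ProperlyDominates G s u w} (Set.toFinite _)
    ⟨s, dominates_start G s w, hw.symm⟩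
  refine ⟨u, hu, fun x hx => ?_⟩
  rcases hx.1.total hG hu.1 with h | h
  · exact h
  · exact hmax hx (fun y hy => Dominates.trans hy h) (dominates_refl G s x)

/-- Induction along the dominator tree, from the start vertex to the leaves. -/
theorem idom_induction (hG : StronglyConnected G) {P : V → Prop}
    (h : ∀ w, (∀ u, IsIdom G s u w → P u) → P w) (w : V) : P w := by
  have wf : WellFounded fun a b : V => {x | Dominates G s x a} ⊂ {x | Dominates G s x b} :=
    InvImage.wf _ (wellFounded_lt (α := Set V))
  refine wf.induction w fun w ih => h w fun u hu => ih u ?_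
  refine ⟨fun x hx => Dominates.trans hx hu.1.1, fun hsub => hu.1.2 ?_⟩
  exact hu.1.1.antisymm hG (hsub (dominates_refl G s w))

theorem descendant_iff (hG : StronglyConnected G) : Descendant G s u w ↔ Dominates G s u w := by
  unfold Descendant
  rw [reaches_iff]
  constructor
  · intro h
    induction h with
    | refl => exact dominates_refl G s u
    | tail _ hab ih => exact ih.trans hab.1.1
  · intro h
    induction w using idom_induction (s := s) hG with
    | h w ih =>
      by_cases huw : u = w
      · exact huw ▸ .refl
      have hws : w ≠ s := fun hws => huw (h.antisymm hG (hws ▸ dominates_start G s u))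
      obtain ⟨d, hd⟩ := exists_isIdom hG hws
      exact (ih d hd (hd.2 u ⟨h, huw⟩)).tail hd

end Dominators

/-! ### Bridges and the trees of the decomposition -/

section Bridges

variable {V : Type*} {G : Digraph V} {s u v w x r : V}

theorem isBridge_iff :
    IsBridge G s u w ↔ G.Adj u w ∧ ¬ ReflTransGen (deleteEdge G u w).Adj s w := by
  unfold IsBridge IsPath
  rw [← exists_chain_iff_reflTransGen]
  refine and_congr_right fun _ => ?_
  push Not
  constructor
  · rintro h p hc hs hw
    obtain ⟨hc, he⟩ := isChain_and_not_hasEdge.2 hc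
    exact he (h p ⟨hc, hs, hw⟩)
  · rintro h p ⟨hc, hs, hw⟩
    by_contra he
    exact h p (isChain_and_not_hasEdge.1 ⟨hc, he⟩) hs hw

/-- A path avoiding `u` cannot use an edge out of `u`; a loop is never needed to reach its own
vertex; and a path to `u` avoiding `x` extends along the bridge to `w`. -/
theorem IsBridge.isIdom (hG : StronglyConnected G) (h : IsBridge G s u w) : IsIdom G s u w := by
  obtain ⟨huw, hb⟩ := isBridge_iff.1 h
  refine ⟨⟨dominates_iff.2 fun h => hb ?_, ?_⟩, fun x hx => ?_⟩
  · suffices w ≠ u ∧ ReflTransGen (deleteEdge G u w).Adj s w from this.2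
    refine ⟨h.ne, ?_⟩
    obtain ⟨hs, h⟩ := h
    have key : ∀ t, ReflTransGen (fun a b => G.Adj a b ∧ b ≠ u) s t →
        t ≠ u ∧ ReflTransGen (deleteEdge G u w).Adj s t := by
      intro t ht
      induction ht with
      | refl => exact ⟨hs, .refl⟩
      | tail _ hab ih => exact ⟨hab.2, ih.2.tail ⟨hab.1, fun h => ih.1 h.1⟩⟩
    exact (key w h).2
  · rintro rfl
    have key : ∀ t, ReflTransGen G.Adj s t → ReflTransGen (deleteEdge G u u).Adj s t := by
      intro t ht
      induction ht with
      | refl => exact .refl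
      | tail _ hab ih => exact ih.tail ⟨hab, fun h => hb (h.1 ▸ ih)⟩
    exact hb (key u (reaches_iff.1 (hG s u)))
  · by_contra hxu
    exact dominates_iff.1 hx.1 ((not_dominates_iff.1 hxu).tail huw hx.2.symm)

/-- A bridge `(u, w)` is the only edge entering the set of vertices dominated by `w`. -/
theorem IsBridge.eq_of_adj (h : IsBridge G s u w) (hxv : G.Adj x v) (hv : Dominates G s w v)
    (hx : ¬ Dominates G s w x) : x = u ∧ v = w := by
  obtain rfl := Dominates.eq_of_adj hxv hv hx
  refine ⟨?_, rfl⟩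
  by_contra hne
  obtain ⟨_, hb⟩ := isBridge_iff.1 h
  obtain ⟨_, hx⟩ := not_dominates_iff.1 hx
  refine hb (ReflTransGen.tail (reflTransGen_of_le hx fun a b hab => ⟨hab.1, fun h => hab.2 h.2⟩)
    ⟨hxv, fun h => hne h.1⟩)

theorem IsBridge.of_isIdom (hG : StronglyConnected G) (hw : Marked G s w)
    (hu : IsIdom G s u w) : IsBridge G s u w := by
  obtain ⟨v, hv⟩ := hw
  rwa [hu.unique hG (hv.isIdom hG)]

/-- If the removal of an edge disconnects `w` from `s`, then the edge is a bridge whose head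
dominates `w`. -/
theorem isBridge_of_not_reflTransGen (hG : StronglyConnected G)
    (h : ¬ ReflTransGen (deleteEdge G u v).Adj s w) : IsBridge G s u v ∧ Dominates G s v w := by
  have hv : ¬ ReflTransGen (deleteEdge G u v).Adj s v := by
    intro hv
    -- Whenever a path uses `(u, v)`, its part up to `v` is replaced by the path `hv`.
    have key : ∀ t, ReflTransGen G.Adj s t → ReflTransGen (deleteEdge G u v).Adj s t := by
      intro t ht
      induction ht with
      | refl => exact .refl
      | @tail b c _ hab ih =>
        by_cases hc : b = u ∧ c = v
        · exact hc.2 ▸ hv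
        · exact ih.tail ⟨hab, hc⟩
    exact h (key w (reaches_iff.1 (hG s w)))
  have huv : G.Adj u v := by
    by_contra huv
    exact hv (reflTransGen_of_le (reaches_iff.1 (hG s v)) fun a b hab =>
      ⟨hab, fun h => huv (h.1 ▸ h.2 ▸ hab)⟩)
  refine ⟨isBridge_iff.2 ⟨huv, hv⟩, dominates_iff.2 fun hw => h ?_⟩
  exact reflTransGen_of_le hw.2 fun a b hab => ⟨hab.1, fun h => hab.2 h.2⟩

theorem subtree_eq_of_isLeaf (hr : IsLeaf G s r) : subtree G s r = {r} := by
  ext v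
  refine ⟨fun h => ?_, fun h => h ▸ mem_subtree_self G s r⟩
  rcases (reaches_iff.1 h).cases_head with h | ⟨c, hc, _⟩
  · exact h.symm
  · exact absurd hc.1 (hr c)

variable [Finite V]

/-- Membership in a tree becomes a statement about dominance alone: every marked ancestor of `v`
lies at or above `r`. -/
theorem mem_subtree_iff (hG : StronglyConnected G) :
    v ∈ subtree G s r ↔
      Dominates G s r v ∧ ∀ z, Marked G s z → Dominates G s z v → Dominates G s z r := by
  change Reaches _ _ _ ↔ _
  rw [reaches_iff]
  constructor
  · intro h
    induction h with
    | refl => exact ⟨dominates_refl G s r, fun z _ h => h⟩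
    | tail _ hab ih =>
      refine ⟨ih.1.trans hab.1.1.1, fun z hz hzv => ih.2 z hz (hab.1.2 z ⟨hzv, ?_⟩)⟩
      rintro rfl
      exact hab.2 hz
  · intro h
    induction v using idom_induction (s := s) hG with
    | h v ih =>
      by_cases hrv : r = v
      · exact hrv ▸ .refl
      have hvs : v ≠ s := fun hvs => hrv (h.1.antisymm hG (hvs ▸ dominates_start G s r))
      obtain ⟨d, hd⟩ := exists_isIdom hG hvs
      refine (ih d hd ⟨hd.2 r ⟨h.1, hrv⟩, fun z hz hzd => h.2 z hz (hzd.trans hd.1.1)⟩).tail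
        ⟨hd, fun hv => ?_⟩
      exact hrv (h.1.antisymm hG (h.2 v hv (dominates_refl G s v)))

theorem exists_root (hG : StronglyConnected G) (s v : V) :
    ∃ r, IsRoot G s r ∧ v ∈ subtree G s r := by
  induction v using idom_induction (s := s) hG with
  | h v ih =>
    by_cases hv : IsRoot G s v
    · exact ⟨v, hv, mem_subtree_self G s v⟩
    simp only [IsRoot, not_or] at hv
    obtain ⟨d, hd⟩ := exists_isIdom hG hv.1
    obtain ⟨r, hr, hdr⟩ := ih d hd
    exact ⟨r, hr, reaches_iff.2 ((reaches_iff.1 hdr).tail ⟨hd, hv.2⟩)⟩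

/-- Removing one edge does not disconnect a vertex of `T(r)` from `r`. -/
theorem reflTransGen_deleteEdge_of_mem_subtree (hG : StronglyConnected G)
    (hv : v ∈ subtree G s r) (a b : V) : ReflTransGen (deleteEdge G a b).Adj r v := by
  rw [mem_subtree_iff hG] at hv
  by_cases h : ReflTransGen (deleteEdge G a b).Adj s v
  · exact reflTransGen_of_le (hv.1.reflTransGen_from (fun _ _ h => h.1) h) fun _ _ h => h.1
  obtain ⟨hb, hbv⟩ := isBridge_of_not_reflTransGen hG h
  -- The head `b` of the bridge dominates `r`, so it can occur below `r` only as `r` itself, and the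
  -- path chosen here never re-enters `r`.
  refine reflTransGen_of_le
    (hv.1.reflTransGen_from (fun _ _ h => h) (reaches_iff.1 (hG s v))) ?_
  rintro x y ⟨hxy, hyr, -, hy⟩
  refine ⟨hxy, ?_⟩
  rintro ⟨rfl, rfl⟩
  exact hyr ((hv.2 y ⟨x, hb⟩ hbv).antisymm hG hy)

end Bridges

/-! ### The auxiliary graph as a contraction of the digraph -/

section Contraction

variable {V : Type*} {G : Digraph V} {s r u v w x y z a b c g h : V}

/-- The vertex `v` of `G` is represented by the vertex `a` of the auxiliary graph `G_r`. -/
def Contracts (G : Digraph V) (s r v a : V) : Prop :=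
  (v ∈ subtree G s r ∧ a = v) ∨ (∃ w, MarkedChild G s r w a ∧ Dominates G s a v) ∨
    (¬ Dominates G s r v ∧ IsIdom G s a r)

open Classical in
/-- The vertex of the auxiliary graph `G_r` that represents `v`. -/
noncomputable def contract (G : Digraph V) (s r v : V) : V :=
  if h : ∃ a, Contracts G s r v a then h.choose else v

/-- `(g, h)` is the edge through which all paths between ordinary vertices that visit the auxiliary
vertex `c` have to pass. -/
def IsGate (G : Digraph V) (s r c g h : V) : Prop :=
  (MarkedChild G s r g h ∧ c = h) ∨ (IsIdom G s c r ∧ g = c ∧ h = r)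

theorem exists_isGate (hc : c ∈ auxVerts G s r) (hc' : c ∉ subtree G s r) :
    ∃ g h, IsGate G s r c g h := by
  rcases hc with hc | ⟨w, hw⟩ | hc
  · exact absurd hc hc'
  · exact ⟨w, c, .inl ⟨hw, rfl⟩⟩
  · exact ⟨c, r, .inr ⟨hc, rfl, rfl⟩⟩

theorem IsGate.mem_auxVerts (hg : IsGate G s r c g h) :
    g ∈ auxVerts G s r ∧ h ∈ auxVerts G s r := by
  rcases hg with ⟨hm, _⟩ | ⟨hi, rfl, rfl⟩
  · exact ⟨.inl hm.1, .inr (.inl ⟨g, hm⟩)⟩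
  · exact ⟨.inr (.inr hi), .inl (mem_subtree_self G s h)⟩

theorem IsGate.eq_or_eq (hg : IsGate G s r c g h) : c = g ∨ c = h := by
  rcases hg with ⟨_, rfl⟩ | ⟨_, rfl, _⟩
  · exact .inr rfl
  · exact .inl rfl

theorem AuxAdj.mem_auxVerts (h : AuxAdj G s r a b) :
    a ∈ auxVerts G s r ∧ b ∈ auxVerts G s r := by
  cases h with
  | ordinary ha hb h => exact ⟨.inl ha, .inl hb⟩
  | leave hz => exact ⟨.inl hz.1, .inr (.inl ⟨_, hz⟩)⟩
  | enter hb => exact ⟨.inr (.inr hb), .inl (mem_subtree_self G s r)⟩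
  | shortcutA h hu hv hb => exact ⟨.inl hu, .inr (.inr hb)⟩
  | shortcutB h hv hz hu => exact ⟨.inr (.inl ⟨_, hz⟩), .inl hv⟩
  | shortcutC h hv hz hu hb => exact ⟨.inr (.inl ⟨_, hz⟩), .inr (.inr hb)⟩

theorem not_dominates_of_isIdom (hG : StronglyConnected G) (hd : IsIdom G s a r) :
    ¬ Dominates G s r a :=
  fun h => hd.1.2 (hd.1.1.antisymm hG h)

theorem MarkedChild.isBridge (hG : StronglyConnected G) (hz : MarkedChild G s r w z) :
    IsBridge G s w z :=
  .of_isIdom hG hz.2.2 hz.2.1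

theorem IsRoot.isBridge (hG : StronglyConnected G) (hr : IsRoot G s r) (hd : IsIdom G s a r) :
    IsBridge G s a r := by
  rcases hr with rfl | hr
  · exact absurd (dominates_start G r a) (not_dominates_of_isIdom hG hd)
  · exact .of_isIdom hG hr hd

variable [Finite V]

theorem MarkedChild.dominates (hG : StronglyConnected G) (hz : MarkedChild G s r w z) :
    Dominates G s r z :=
  ((mem_subtree_iff hG).1 hz.1).1.trans hz.2.1.1.1

/-- A marked dominator of a vertex of $T(r)$ dominates `r`, hence would dominate its own parent `w`.
-/
theorem MarkedChild.not_dominates (hG : StronglyConnected G) (hz : MarkedChild G s r w z)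
    (hv : v ∈ subtree G s r) : ¬ Dominates G s z v := by
  intro hzv
  have hzr := ((mem_subtree_iff hG).1 hv).2 z hz.2.2 hzv
  have hrw := ((mem_subtree_iff hG).1 hz.1).1
  exact not_dominates_of_isIdom hG hz.2.1 (hzr.trans hrw)

theorem MarkedChild.notMem (hG : StronglyConnected G) (hz : MarkedChild G s r w z) :
    z ∉ subtree G s r :=
  fun h => hz.not_dominates hG h (dominates_refl G s z)

theorem MarkedChild.not_isIdom (hG : StronglyConnected G) (hz : MarkedChild G s r w z) :
    ¬ IsIdom G s z r :=
  fun h => not_dominates_of_isIdom hG h (hz.dominates hG)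

theorem notMem_of_isIdom (hG : StronglyConnected G) (hd : IsIdom G s a r) :
    a ∉ subtree G s r :=
  fun h => not_dominates_of_isIdom hG hd ((mem_subtree_iff hG).1 h).1

/-- Two dominators of `v` are comparable; if they differed, the upper one would dominate the parent
of the lower one, which lies in $T(r)$. -/
theorem MarkedChild.eq_of_dominates (hG : StronglyConnected G) (hz : MarkedChild G s r w z)
    (ha : MarkedChild G s r u a) (hzv : Dominates G s z v) (hav : Dominates G s a v) : z = a := by
  by_contra hne
  rcases hzv.total hG hav with h | h
  · exact hz.not_dominates hG ha.1 (ha.2.1.2 z ⟨h, hne⟩)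
  · exact ha.not_dominates hG hz.1 (hz.2.1.2 a ⟨h, Ne.symm hne⟩)

/-- Descending from `r` to `v` in the dominator tree, one either stays in $T(r)$ or leaves it for
good at a marked child. -/
theorem exists_contracts (hG : StronglyConnected G) (v : V) :
    ∃ a, Contracts G s r v a := by
  by_cases hrv : Dominates G s r v
  · suffices v ∈ subtree G s r ∨ ∃ a w, MarkedChild G s r w a ∧ Dominates G s a v by
      rcases this with h | ⟨a, h⟩
      · exact ⟨v, .inl ⟨h, rfl⟩⟩
      · exact ⟨a, .inr (.inl h)⟩
    induction v using idom_induction (s := s) hG with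
    | h v ih =>
      by_cases hne : r = v
      · exact .inl (hne ▸ mem_subtree_self G s r)
      have hvs : v ≠ s := fun hvs => hne (hrv.antisymm hG (hvs ▸ dominates_start G s r))
      obtain ⟨d, hd⟩ := exists_isIdom hG hvs
      rcases ih d hd (hd.2 r ⟨hrv, hne⟩) with hdr | ⟨a, w, hw, had⟩
      · by_cases hv : Marked G s v
        · exact .inr ⟨v, d, ⟨hdr, hd, hv⟩, dominates_refl G s v⟩
        · exact .inl (reaches_iff.2 ((reaches_iff.1 hdr).tail ⟨hd, hv⟩))
      · exact .inr ⟨a, w, hw, had.trans hd.1.1⟩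
  · have hrs : r ≠ s := fun h => hrv (h ▸ dominates_start G r v)
    obtain ⟨d, hd⟩ := exists_isIdom hG hrs
    exact ⟨d, .inr (.inr ⟨hrv, hd⟩)⟩

theorem Contracts.unique (hG : StronglyConnected G) (ha : Contracts G s r v a)
    (hb : Contracts G s r v b) : a = b := by
  rcases ha with ⟨hv, rfl⟩ | ⟨w, hw, hav⟩ | ⟨hv, hi⟩ <;>
    rcases hb with ⟨hv', rfl⟩ | ⟨w', hw', hbv⟩ | ⟨hv', hi'⟩
  · rfl
  · exact absurd hbv (hw'.not_dominates hG hv)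
  · exact absurd ((mem_subtree_iff hG).1 hv).1 hv'
  · exact absurd hav (hw.not_dominates hG hv')
  · exact hw.eq_of_dominates hG hw' hav hbv
  · exact absurd ((hw.dominates hG).trans hav) hv'
  · exact absurd ((mem_subtree_iff hG).1 hv').1 hv
  · exact absurd ((hw'.dominates hG).trans hbv) hv
  · exact hi.unique hG hi'

theorem contract_eq_iff (hG : StronglyConnected G) :
    contract G s r v = a ↔ Contracts G s r v a := by
  have h : Contracts G s r v (contract G s r v) := by
    rw [contract, dif_pos (exists_contracts hG v)]
    exact (exists_contracts hG v).choose_spec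
  exact ⟨fun ha => ha ▸ h, fun ha => h.unique hG ha⟩

theorem contract_of_mem (hG : StronglyConnected G) (hv : v ∈ subtree G s r) :
    contract G s r v = v :=
  (contract_eq_iff hG).2 (.inl ⟨hv, rfl⟩)

theorem contract_of_dominates (hG : StronglyConnected G)
    (hz : MarkedChild G s r w z) (hv : Dominates G s z v) : contract G s r v = z :=
  (contract_eq_iff hG).2 (.inr (.inl ⟨w, hz, hv⟩))

theorem contract_of_not_dominates (hG : StronglyConnected G)
    (hd : IsIdom G s a r) (hv : ¬ Dominates G s r v) : contract G s r v = a :=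
  (contract_eq_iff hG).2 (.inr (.inr ⟨hv, hd⟩))

theorem contract_of_mem_auxVerts (hG : StronglyConnected G)
    (hv : v ∈ auxVerts G s r) : contract G s r v = v := by
  rcases hv with hv | ⟨w, hw⟩ | hv
  · exact contract_of_mem hG hv
  · exact contract_of_dominates hG hw (dominates_refl G s v)
  · exact contract_of_not_dominates hG hv (not_dominates_of_isIdom hG hv)

theorem eq_of_contract_eq_mem (hG : StronglyConnected G)
    (h : contract G s r v = a) (ha : a ∈ subtree G s r) : v = a := by
  rcases (contract_eq_iff hG).1 h with ⟨_, rfl⟩ | ⟨w, hw, _⟩ | ⟨_, hi⟩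
  · rfl
  · exact absurd ha (hw.notMem hG)
  · exact absurd ha (notMem_of_isIdom hG hi)

theorem contract_mem_auxVerts (hG : StronglyConnected G) (v : V) :
    contract G s r v ∈ auxVerts G s r := by
  rcases (contract_eq_iff hG).1 (rfl : contract G s r v = _) with ⟨hv, h⟩ | ⟨w, hw, _⟩ | ⟨_, hi⟩
  · exact .inl (h.symm ▸ hv)
  · exact .inr (.inl ⟨w, hw⟩)
  · exact .inr (.inr hi)

/-! ### Projecting paths of the digraph to the auxiliary graph -/

/-- An edge entering the class of a marked child, or leaving the class of $d(r)$ into $T(r)$, is the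
bridge itself. The remaining edges between different classes are ordinary or give shortcuts. -/
theorem auxAdj_contract (hG : StronglyConnected G) (hr : IsRoot G s r) (huv : G.Adj u v) :
    contract G s r u = contract G s r v ∨
      AuxAdj G s r (contract G s r u) (contract G s r v) := by
  have hu := (contract_eq_iff hG).1 (rfl : contract G s r u = _)
  have hv := (contract_eq_iff hG).1 (rfl : contract G s r v = _)
  generalize contract G s r u = a at *
  generalize contract G s r v = b at *
  by_cases hab : a = b
  · exact .inl hab
  refine .inr ?_
  rcases hv with ⟨hv, rfl⟩ | ⟨w', hw', hbv⟩ | ⟨hv, hi'⟩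
  · rcases hu with ⟨hu, rfl⟩ | ⟨w, hw, hau⟩ | ⟨hu, hi⟩
    · exact .ordinary hu hv huv
    · exact .shortcutB huv hv hw ((descendant_iff hG).2 hau)
    · obtain ⟨rfl, rfl⟩ := (hr.isBridge hG hi).eq_of_adj huv ((mem_subtree_iff hG).1 hv).1 hu
      exact .enter hi
  · by_cases hbu : Dominates G s b u
    · have hub : Contracts G s r u b := .inr (.inl ⟨w', hw', hbu⟩)
      exact absurd (hu.unique hG hub) hab
    · obtain ⟨rfl, rfl⟩ := (hw'.isBridge hG).eq_of_adj huv hbv hbu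
      rw [hu.unique hG (.inl ⟨hw'.1, rfl⟩)]
      exact .leave hw'
  · have hv' : ¬ Descendant G s r v := fun h => hv ((descendant_iff hG).1 h)
    rcases hu with ⟨hu, rfl⟩ | ⟨w, hw, hau⟩ | ⟨hu, hi⟩
    · exact .shortcutA huv hu hv' hi'
    · exact .shortcutC huv hv' hw ((descendant_iff hG).2 hau) hi'
    · exact absurd (hi.unique hG hi') hab

/-- Paths of `G` project to paths of `G_r`. -/
theorem reflTransGen_contract (hG : StronglyConnected G) (hr : IsRoot G s r)
    {R S : V → V → Prop} (hR : ∀ u v, R u v → G.Adj u v)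
    (hS : ∀ u v, R u v → AuxAdj G s r (contract G s r u) (contract G s r v) →
      S (contract G s r u) (contract G s r v))
    (h : ReflTransGen R x y) : ReflTransGen S (contract G s r x) (contract G s r y) := by
  induction h with
  | refl => exact .refl
  | tail _ hab ih =>
    rcases auxAdj_contract hG hr (hR _ _ hab) with h | h
    · exact h ▸ ih
    · exact ih.tail (hS _ _ hab h)

/-! ### Lifting paths of the auxiliary graph to the digraph -/

theorem MarkedChild.reflTransGen_of_dominates (hG : StronglyConnected G)
    (hz : MarkedChild G s r w z) (hv : Dominates G s z v) :
    ReflTransGen (fun p q => G.Adj p q ∧ contract G s r p = z ∧ contract G s r q = z) z v :=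
  reflTransGen_of_le (hv.reflTransGen_from (fun _ _ h => h) (reaches_iff.1 (hG s v)))
    fun _ _ h => ⟨h.1, contract_of_dominates hG hz h.2.2.1,
      contract_of_dominates hG hz h.2.2.2⟩

/-- On any path from `v` to `r`, the first edge into the vertices dominated by `r` is the bridge,
and its tail is $d(r)$. -/
theorem reflTransGen_idom_of_not_dominates (hG : StronglyConnected G) (hr : IsRoot G s r)
    (hd : IsIdom G s a r) (hv : ¬ Dominates G s r v) :
    ReflTransGen (fun p q => G.Adj p q ∧ contract G s r p = a ∧ contract G s r q = a) v a := by
  have h := reaches_iff.1 (hG v r)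
  induction h using ReflTransGen.head_induction_on with
  | refl => exact absurd (dominates_refl G s r) hv
  | @head p q hpq _ ih =>
    by_cases hq : Dominates G s r q
    · obtain ⟨rfl, -⟩ := (hr.isBridge hG hd).eq_of_adj hpq hq hv
      exact .refl
    · exact .head ⟨hpq, contract_of_not_dominates hG hd hv,
        contract_of_not_dominates hG hd hq⟩ (ih hq)

/-- A shortcut unfolds into one edge between the two classes and detours inside the classes of its
auxiliary ends. The disjunction records this so that a lifted path can be checked against a deleted
edge. -/
theorem AuxAdj.reflTransGen (hG : StronglyConnected G) (hr : IsRoot G s r)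
    (h : AuxAdj G s r a b) :
    ReflTransGen (fun p q => G.Adj p q ∧ ((contract G s r p = a ∧ contract G s r q = b) ∨
      (contract G s r p = contract G s r q ∧ contract G s r p ∉ subtree G s r ∧
        (contract G s r p = a ∨ contract G s r p = b)))) a b := by
  cases h with
  | ordinary ha hb h =>
    exact .single ⟨h, .inl ⟨contract_of_mem hG ha, contract_of_mem hG hb⟩⟩
  | leave hz =>
    exact .single ⟨(hz.isBridge hG).1, .inl ⟨contract_of_mem hG hz.1,
      contract_of_dominates hG hz (dominates_refl G s _)⟩⟩
  | enter hb =>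
    exact .single ⟨(hr.isBridge hG hb).1,
      .inl ⟨contract_of_not_dominates hG hb (not_dominates_of_isIdom hG hb),
        contract_of_mem hG (mem_subtree_self G s _)⟩⟩
  | @shortcutA _ v _ h hu hv hb =>
    rw [descendant_iff hG] at hv
    refine .head ⟨h, .inl ⟨contract_of_mem hG hu, contract_of_not_dominates hG hb hv⟩⟩
      (reflTransGen_of_le (reflTransGen_idom_of_not_dominates hG hr hb hv) ?_)
    rintro p q ⟨hpq, hp, hq⟩
    exact ⟨hpq, .inr ⟨hp.trans hq.symm, hp ▸ notMem_of_isIdom hG hb, .inr hp⟩⟩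
  | @shortcutB u _ w _ h hv hz hu =>
    rw [descendant_iff hG] at hu
    refine ReflTransGen.tail (reflTransGen_of_le (hz.reflTransGen_of_dominates hG hu) ?_)
      ⟨h, .inl ⟨contract_of_dominates hG hz hu, contract_of_mem hG hv⟩⟩
    rintro p q ⟨hpq, hp, hq⟩
    exact ⟨hpq, .inr ⟨hp.trans hq.symm, hp ▸ hz.notMem hG, .inl hp⟩⟩
  | @shortcutC u v w _ _ h hv hz hu hb =>
    rw [descendant_iff hG] at hu hv
    refine (ReflTransGen.tail (reflTransGen_of_le (hz.reflTransGen_of_dominates hG hu) ?_)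
      ⟨h, .inl ⟨contract_of_dominates hG hz hu, contract_of_not_dominates hG hb hv⟩⟩).trans
      (reflTransGen_of_le (reflTransGen_idom_of_not_dominates hG hr hb hv) ?_)
    · rintro p q ⟨hpq, hp, hq⟩
      exact ⟨hpq, .inr ⟨hp.trans hq.symm, hp ▸ hz.notMem hG, .inl hp⟩⟩
    · rintro p q ⟨hpq, hp, hq⟩
      exact ⟨hpq, .inr ⟨hp.trans hq.symm, hp ▸ notMem_of_isIdom hG hb, .inr hp⟩⟩

/-- Paths of `G_r` lift to paths of `G`. -/
theorem reflTransGen_of_auxAdj (hG : StronglyConnected G) (hr : IsRoot G s r)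
    {R S : V → V → Prop} (hS : ∀ a b, S a b → AuxAdj G s r a b)
    (hSR : ∀ u v, G.Adj u v → S (contract G s r u) (contract G s r v) → R u v)
    (hR : ∀ u v, G.Adj u v → contract G s r u = contract G s r v →
      contract G s r u ∉ subtree G s r →
      (∃ a b, S a b ∧ (contract G s r u = a ∨ contract G s r u = b)) → R u v)
    (h : ReflTransGen S x y) : ReflTransGen R x y := by
  induction h with
  | refl => exact .refl
  | @tail a b _ hab ih =>
    refine ih.trans (reflTransGen_of_le ((hS _ _ hab).reflTransGen hG hr) ?_)
    rintro p q ⟨hpq, ⟨rfl, rfl⟩ | ⟨he, hn, hp⟩⟩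
    · exact hSR p q hpq hab
    · exact hR p q hpq he hn ⟨a, b, hab, hp⟩

/-! ### Edge removal in the digraph and in the auxiliary graph -/

/-- Without its gate, the class of a marked child cannot be entered and the class of $d(r)$ cannot
be left, so a path between ordinary vertices misses the class. -/
theorem IsGate.auxAdj_avoiding_of_deleteEdge (hG : StronglyConnected G) (hr : IsRoot G s r)
    (hg : IsGate G s r c g h) (hx : x ∈ subtree G s r) (hy : y ∈ subtree G s r)
    (hxy : ReflTransGen (deleteEdge G g h).Adj x y) :
    ReflTransGen (fun a b => AuxAdj G s r a b ∧ a ≠ c ∧ b ≠ c) x y := by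
  have key : ReflTransGen (fun a b => (deleteEdge G g h).Adj a b ∧
      a ∉ {v | contract G s r v = c} ∧ b ∉ {v | contract G s r v = c}) x y := by
    rcases hg with ⟨hm, rfl⟩ | ⟨hi, rfl, rfl⟩
    · have hC : ∀ v, contract G s r v = c ↔ Dominates G s c v := by
        refine fun v => ⟨fun h => ?_, contract_of_dominates hG hm⟩
        rcases (contract_eq_iff hG).1 h with ⟨h, rfl⟩ | ⟨_, _, h⟩ | ⟨_, h⟩
        · exact dominates_refl G s c
        · exact h
        · exact absurd h (hm.not_isIdom hG)
      simp only [hC]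
      refine reflTransGen_confine hxy (hm.not_dominates hG hx) (hm.not_dominates hG hy) (.inl ?_)
      intro a b hab hb
      by_contra ha
      exact hab.2 ((hm.isBridge hG).eq_of_adj hab.1 hb ha)
    · have hC : ∀ v, contract G s h v = g ↔ ¬ Dominates G s h v := by
        refine fun v => ⟨fun h => ?_, contract_of_not_dominates hG hi⟩
        rcases (contract_eq_iff hG).1 h with ⟨_, rfl⟩ | ⟨_, h, _⟩ | ⟨h, _⟩
        · exact not_dominates_of_isIdom hG hi
        · exact absurd hi (h.not_isIdom hG)
        · exact h
      simp only [hC]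
      refine reflTransGen_confine hxy (fun h => h ((mem_subtree_iff hG).1 hx).1)
        (fun h => h ((mem_subtree_iff hG).1 hy).1) (.inr ?_)
      intro a b hab ha hb
      exact hab.2 ((hr.isBridge hG hi).eq_of_adj hab.1 hb ha)
  have := reflTransGen_contract hG hr (S := fun a b => AuxAdj G s r a b ∧ a ≠ c ∧ b ≠ c)
    (fun _ _ h => h.1.1) (fun _ _ h h' => ⟨h', h.2⟩) key
  rwa [contract_of_mem hG hx, contract_of_mem hG hy] at this

/-- The same confinement inside $G_r$: `leave` is the only way into a marked child, and `enter` the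
only way out of $d(r)$. -/
theorem IsGate.auxAdj_avoiding (hG : StronglyConnected G)
    (hg : IsGate G s r c g h) (hx : x ∈ subtree G s r) (hy : y ∈ subtree G s r)
    (hxy : ReflTransGen (fun a b => AuxAdj G s r a b ∧ ¬ (a = g ∧ b = h)) x y) :
    ReflTransGen (fun a b => AuxAdj G s r a b ∧ a ≠ c ∧ b ≠ c) x y := by
  have hc : c ∉ subtree G s r := by
    rcases hg with ⟨hm, rfl⟩ | ⟨hi, -, -⟩
    · exact hm.notMem hG
    · exact notMem_of_isIdom hG hi
  refine reflTransGen_of_le (reflTransGen_confine (C := {c}) hxy (fun h => hc (h ▸ hx))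
    (fun h => hc (h ▸ hy)) ?_) fun _ _ h => ⟨h.1.1, h.2⟩
  rcases hg with ⟨hm, rfl⟩ | ⟨hi, rfl, rfl⟩
  · left
    rintro a b ⟨hab, hne⟩ rfl
    exfalso
    cases hab with
    | ordinary ha hb h => exact hc hb
    | leave hz => exact hne ⟨hz.2.1.unique hG hm.2.1, rfl⟩
    | enter hb => exact hc (mem_subtree_self G s _)
    | shortcutA h hu hv hb => exact hm.not_isIdom hG hb
    | shortcutB h hv hz hu => exact hc hv
    | shortcutC h hv hz hu hb => exact hm.not_isIdom hG hb
  · right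
    rintro a b ⟨hab, hne⟩ rfl
    exfalso
    cases hab with
    | ordinary ha hb h => exact hc ha
    | leave hz => exact hc hz.1
    | enter hb => exact hne ⟨rfl, rfl⟩
    | shortcutA h hu hv hb => exact hc hu
    | shortcutB h hv hz hu => exact hz.not_isIdom hG hi
    | shortcutC h hv hz hu hb => exact hz.not_isIdom hG hi

theorem reflTransGen_avoiding_of_auxAdj (hG : StronglyConnected G) (hr : IsRoot G s r)
    (hxy : ReflTransGen (fun a b => AuxAdj G s r a b ∧ a ≠ c ∧ b ≠ c) x y) :
    ReflTransGen (fun a b => G.Adj a b ∧ contract G s r a ≠ c ∧ contract G s r b ≠ c) x y := by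
  refine reflTransGen_of_auxAdj hG hr (fun _ _ h => h.1) (fun u v h hS => ⟨h, hS.2⟩) ?_ hxy
  rintro u v huv he - ⟨a, b, ⟨-, ha, hb⟩, rfl | rfl⟩
  · exact ⟨huv, ha, he ▸ ha⟩
  · exact ⟨huv, hb, he ▸ hb⟩

/-- Both sides amount to paths of $G_r$ avoiding `c`, since `c` is an end of its own gate. -/
theorem IsGate.reflTransGen_iff (hG : StronglyConnected G) (hr : IsRoot G s r)
    (hg : IsGate G s r c g h) (hx : x ∈ subtree G s r) (hy : y ∈ subtree G s r) :
    ReflTransGen (deleteEdge G g h).Adj x y ↔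
      ReflTransGen (fun a b => AuxAdj G s r a b ∧ ¬ (a = g ∧ b = h)) x y := by
  constructor
  · intro h'
    refine reflTransGen_of_le (hg.auxAdj_avoiding_of_deleteEdge hG hr hx hy h') ?_
    rintro a b ⟨hab, ha, hb⟩
    refine ⟨hab, ?_⟩
    rintro ⟨rfl, rfl⟩
    exact hg.eq_or_eq.elim ha.symm hb.symm
  · intro h'
    refine reflTransGen_of_le
      (reflTransGen_avoiding_of_auxAdj hG hr (hg.auxAdj_avoiding hG hx hy h')) ?_
    rintro a b ⟨hab, ha, hb⟩
    refine ⟨hab, ?_⟩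
    rintro ⟨rfl, rfl⟩
    rw [contract_of_mem_auxVerts hG hg.mem_auxVerts.1] at ha
    rw [contract_of_mem_auxVerts hG hg.mem_auxVerts.2] at hb
    exact hg.eq_or_eq.elim ha.symm hb.symm

/-- For every edge of `G_r` there is an edge of `G` whose removal is at least as harmful to the
paths between ordinary vertices. -/
theorem exists_edge_of_auxEdge (hG : StronglyConnected G) (hr : IsRoot G s r)
    (ha : a ∈ auxVerts G s r) (hb : b ∈ auxVerts G s r) :
    ∃ u v, ∀ x ∈ subtree G s r, ∀ y ∈ subtree G s r,
      ReflTransGen (deleteEdge G u v).Adj x y →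
        ReflTransGen (fun p q => AuxAdj G s r p q ∧ ¬ (p = a ∧ q = b)) x y := by
  by_cases hab : a ∈ subtree G s r ∧ b ∈ subtree G s r
  · refine ⟨a, b, fun x hx y hy h => ?_⟩
    have := reflTransGen_contract hG hr
      (S := fun p q => AuxAdj G s r p q ∧ ¬ (p = a ∧ q = b)) (fun _ _ h => h.1)
      (fun u v h h' => ⟨h', fun he => h.2 ⟨eq_of_contract_eq_mem hG he.1 hab.1,
        eq_of_contract_eq_mem hG he.2 hab.2⟩⟩) h
    rwa [contract_of_mem hG hx, contract_of_mem hG hy] at this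
  -- The edge has an auxiliary end `c`; deleting the gate of `c` forbids every visit to `c`.
  · obtain ⟨c, hc, hc', hcab⟩ : ∃ c ∈ auxVerts G s r, c ∉ subtree G s r ∧ (c = a ∨ c = b) := by
      by_cases h : a ∈ subtree G s r
      · exact ⟨b, hb, fun h' => hab ⟨h, h'⟩, .inr rfl⟩
      · exact ⟨a, ha, h, .inl rfl⟩
    obtain ⟨g, h, hg⟩ := exists_isGate hc hc'
    refine ⟨g, h, fun x hx y hy h => ?_⟩
    refine reflTransGen_of_le (hg.auxAdj_avoiding_of_deleteEdge hG hr hx hy h) ?_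
    rintro p q ⟨hpq, hp, hq⟩
    refine ⟨hpq, ?_⟩
    rintro ⟨rfl, rfl⟩
    exact hcab.elim hp.symm hq.symm

/-- For every edge of `G` there is an edge of `G_r` whose removal is at least as harmful to the
paths between ordinary vertices. -/
theorem exists_auxEdge_of_edge (hG : StronglyConnected G) (hr : IsRoot G s r) (u v : V) :
    ∃ a ∈ auxVerts G s r, ∃ b ∈ auxVerts G s r, ∀ x ∈ subtree G s r, ∀ y ∈ subtree G s r,
      ReflTransGen (fun p q => AuxAdj G s r p q ∧ ¬ (p = a ∧ q = b)) x y →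
        ReflTransGen (deleteEdge G u v).Adj x y := by
  -- An edge collapsed inside an auxiliary class has no image, so the gate of that class is deleted
  -- instead; otherwise the image of the edge serves.
  by_cases huv : contract G s r u = contract G s r v ∧ contract G s r u ∉ subtree G s r
  · obtain ⟨g, h, hg⟩ := exists_isGate (contract_mem_auxVerts hG u) huv.2
    refine ⟨g, hg.mem_auxVerts.1, h, hg.mem_auxVerts.2, fun x hx y hy h => ?_⟩
    refine reflTransGen_of_le
      (reflTransGen_avoiding_of_auxAdj hG hr (hg.auxAdj_avoiding hG hx hy h)) ?_
    rintro p q ⟨hpq, hp, -⟩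
    refine ⟨hpq, ?_⟩
    rintro ⟨rfl, -⟩
    exact hp rfl
  · refine ⟨_, contract_mem_auxVerts hG u, _, contract_mem_auxVerts hG v,
      fun x hx y hy h => reflTransGen_of_auxAdj hG hr (fun _ _ h => h.1) ?_ ?_ h⟩
    · rintro p q hpq ⟨-, hne⟩
      refine ⟨hpq, ?_⟩
      rintro ⟨rfl, rfl⟩
      exact hne ⟨rfl, rfl⟩
    · rintro p q hpq he hn -
      refine ⟨hpq, ?_⟩
      rintro ⟨rfl, rfl⟩
      exact huv ⟨he, hn⟩

end Contraction

/-! ### Two-edge-connectivity -/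

section TwoEdgeConnectivity

variable {V : Type*} {G : Digraph V} {s r u v w x y : V}

theorem sameSCC_iff :
    SameSCC G v w ↔ ReflTransGen G.Adj v w ∧ ReflTransGen G.Adj w v := by
  rw [SameSCC, reaches_iff, reaches_iff]

theorem SameSCC.symm (h : SameSCC G v w) : SameSCC G w v := ⟨h.2, h.1⟩

theorem SameSCC.trans (h : SameSCC G u v) (h' : SameSCC G v w) : SameSCC G u w := by
  rw [sameSCC_iff] at *
  exact ⟨h.1.trans h'.1, h'.2.trans h.2⟩

theorem sameSCC_refl (G : Digraph V) (v : V) : SameSCC G v v :=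
  sameSCC_iff.2 ⟨.refl, .refl⟩

/-- Deleting a non-edge changes nothing, so arbitrary pairs are allowed. Deletions in $G$ and $G_r$
can then be matched without checking that the pairs are edges. -/
theorem twoEdgeConnected_iff :
    TwoEdgeConnected G v w ↔ ∀ x y, SameSCC (deleteEdge G x y) v w := by
  simp only [TwoEdgeConnected, sameSCC_iff]
  constructor
  · rintro ⟨h, h'⟩ x y
    by_cases hxy : G.Adj x y
    · exact h' x y hxy
    · have hle : ∀ a b, G.Adj a b → (deleteEdge G x y).Adj a b :=
        fun a b hab => ⟨hab, fun he => hxy (he.1 ▸ he.2 ▸ hab)⟩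
      exact ⟨reflTransGen_of_le h.1 hle, reflTransGen_of_le h.2 hle⟩
  · intro h
    have hle : ∀ a b, (deleteEdge G v w).Adj a b → G.Adj a b := fun _ _ h => h.1
    -- Any pair would do here; `(v, w)` is one at hand.
    exact ⟨⟨reflTransGen_of_le (h v w).1 hle, reflTransGen_of_le (h v w).2 hle⟩,
      fun x y _ => h x y⟩

theorem twoEdgeConnected_refl (G : Digraph V) (v : V) : TwoEdgeConnected G v v :=
  twoEdgeConnected_iff.2 fun _ _ => sameSCC_refl _ v

theorem TwoEdgeConnected.symm (h : TwoEdgeConnected G v w) : TwoEdgeConnected G w v :=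
  twoEdgeConnected_iff.2 fun x y => (twoEdgeConnected_iff.1 h x y).symm

theorem TwoEdgeConnected.trans (h : TwoEdgeConnected G u v) (h' : TwoEdgeConnected G v w) :
    TwoEdgeConnected G u w :=
  twoEdgeConnected_iff.2 fun x y =>
    (twoEdgeConnected_iff.1 h x y).trans (twoEdgeConnected_iff.1 h' x y)

/-- The 2-edge-connected blocks are the classes of 2-edge-connected vertices. -/
theorem isTwoEdgeConnectedBlock_iff [Nonempty V] {B : Set V} :
    IsTwoEdgeConnectedBlock G B ↔ ∃ v, B = {w | TwoEdgeConnected G v w} := by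
  have hclass : ∀ v, ∀ a ∈ {w | TwoEdgeConnected G v w}, ∀ b ∈ {w | TwoEdgeConnected G v w},
      TwoEdgeConnected G a b := fun v a ha b hb => ha.symm.trans hb
  constructor
  · rintro ⟨hB, hmax⟩
    obtain ⟨v, hv⟩ : ∃ v, B ⊆ {w | TwoEdgeConnected G v w} := by
      -- The empty set lies in every class, so maximality is contradicted only if some class exists.
      rcases B.eq_empty_or_nonempty with rfl | ⟨v, hv⟩
      · exact ⟨Classical.arbitrary V, Set.empty_subset _⟩
      · exact ⟨v, fun w hw => hB v hv w hw⟩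
    exact ⟨v, hv.antisymm (hmax (hclass v) hv)⟩
  · rintro ⟨v, rfl⟩
    exact ⟨hclass v, fun C hC hsub w hw => hC v (hsub (twoEdgeConnected_refl G v)) w hw⟩

theorem reflTransGen_reverse_deleteEdge (G : Digraph V) (u v x y : V) :
    ReflTransGen (deleteEdge (reverse G) u v).Adj x y ↔
      ReflTransGen (deleteEdge G v u).Adj y x := by
  rw [← reflTransGen_swap]
  have : Function.swap (deleteEdge (reverse G) u v).Adj = (deleteEdge G v u).Adj := by
    funext a b
    simp only [Function.swap, deleteEdge, reverse, and_comm]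
  rw [this]

theorem twoEdgeConnected_reverse :
    TwoEdgeConnected (reverse G) v w ↔ TwoEdgeConnected G v w := by
  simp only [twoEdgeConnected_iff, sameSCC_iff, reflTransGen_reverse_deleteEdge]
  exact ⟨fun h x y => (h y x).symm, fun h x y => (h y x).symm⟩

theorem StronglyConnected.reverse (hG : StronglyConnected G) : StronglyConnected (reverse G) :=
  fun v w => reaches_iff.2 (reflTransGen_swap.1 (reaches_iff.1 (hG w v)))

theorem reflTransGen_coe_iff {S : Set V} {R : V → V → Prop} (hR : ∀ a b, R a b → b ∈ S)
    {a b : S} : ReflTransGen (fun p q : S => R p q) a b ↔ ReflTransGen R a b := by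
  constructor
  · exact fun h => ReflTransGen.lift Subtype.val (fun _ _ h => h) _ _ h
  · obtain ⟨b, hb⟩ := b
    intro h
    simp only at h
    induction h with
    | refl => exact .refl
    | @tail c d hc hcd ih =>
      rcases hc.cases_tail with h | ⟨e, _, he⟩
      · subst h
        exact .single hcd
      · exact (ih (hR _ _ he)).tail hcd

theorem reflTransGen_deleteEdge_auxGraph {x y a b : auxVerts G s r} :
    ReflTransGen (deleteEdge (auxGraph G s r) a b).Adj x y ↔
      ReflTransGen (fun p q => AuxAdj G s r p q ∧ ¬ (p = a ∧ q = b)) (x : V) y := by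
  rw [← reflTransGen_coe_iff fun _ _ h => h.1.mem_auxVerts.2]
  simp only [deleteEdge, auxGraph, Subtype.ext_iff]

variable [Finite V]

/-- 2-edge-connected vertices lie in the same tree of the decomposition. -/
theorem TwoEdgeConnected.mem_subtree (hG : StronglyConnected G) (hr : IsRoot G s r)
    (h : TwoEdgeConnected G x y) (hx : x ∈ subtree G s r) : y ∈ subtree G s r := by
  -- Once the bridge into `z` is deleted, nothing enters the set of vertices dominated by `z`.
  have key : ∀ a b z, TwoEdgeConnected G a b → Marked G s z → Dominates G s z b →
      Dominates G s z a := by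
    rintro a b z hab ⟨d, hd⟩ hb
    by_contra ha
    have hpath := (sameSCC_iff.1 (twoEdgeConnected_iff.1 hab d z)).1
    refine dominates_iff.1 hb ?_
    have : ∀ t, ReflTransGen (deleteEdge G d z).Adj a t → ReachesAvoiding G s z t := by
      intro t ht
      induction ht with
      | refl => exact not_dominates_iff.1 ha
      | @tail p q _ hpq ih =>
        refine not_dominates_iff.1 fun hq => hpq.2 ?_
        exact hd.eq_of_adj hpq.1 hq (not_dominates_iff.2 ih)
    exact this b hpath
  rw [mem_subtree_iff hG] at hx ⊢
  refine ⟨?_, fun z hz hzy => hx.2 z hz (key x y z h hz hzy)⟩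
  rcases hr with rfl | hr
  · exact dominates_start G r y
  · exact key y x r h.symm hr hx.1

theorem stronglyConnected_auxGraph (hG : StronglyConnected G) (hr : IsRoot G s r) :
    StronglyConnected (auxGraph G s r) := by
  intro x y
  rw [reaches_iff]
  refine (reflTransGen_coe_iff fun _ _ h => h.mem_auxVerts.2).2 ?_
  have := reflTransGen_contract hG hr (S := AuxAdj G s r) (fun _ _ h => h) (fun _ _ _ h => h)
    (reaches_iff.1 (hG x y))
  rwa [contract_of_mem_auxVerts hG x.2, contract_of_mem_auxVerts hG y.2] at this

/-- Ordinary vertices are 2-edge-connected in `G_r` if and only if they are so in `G`. -/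
theorem twoEdgeConnected_auxGraph_iff (hG : StronglyConnected G) (hr : IsRoot G s r)
    {x y : auxVerts G s r} (hx : (x : V) ∈ subtree G s r) (hy : (y : V) ∈ subtree G s r) :
    TwoEdgeConnected (auxGraph G s r) x y ↔ TwoEdgeConnected G x y := by
  simp only [twoEdgeConnected_iff, sameSCC_iff, reflTransGen_deleteEdge_auxGraph]
  constructor
  · intro h u v
    obtain ⟨a, ha, b, hb, hab⟩ := exists_auxEdge_of_edge hG hr u v
    exact ⟨hab x hx y hy (h ⟨a, ha⟩ ⟨b, hb⟩).1, hab y hy x hx (h ⟨a, ha⟩ ⟨b, hb⟩).2⟩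
  · intro h a b
    obtain ⟨u, v, huv⟩ := exists_edge_of_auxEdge hG hr a.2 b.2
    exact ⟨huv x hx y hy (h u v).1, huv y hy x hx (h u v).2⟩

/-- Removing one edge of `G_r` does not disconnect an ordinary vertex from `r`. -/
theorem reflTransGen_deleteEdge_auxRoot (hG : StronglyConnected G) (hr : IsRoot G s r)
    {x : auxVerts G s r} (hx : (x : V) ∈ subtree G s r) (a b : auxVerts G s r) :
    ReflTransGen (deleteEdge (auxGraph G s r) a b).Adj (auxRoot G s r) x := by
  rw [reflTransGen_deleteEdge_auxGraph]
  obtain ⟨u, v, huv⟩ := exists_edge_of_auxEdge hG hr a.2 b.2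
  exact huv r (mem_subtree_self G s r) x hx (reflTransGen_deleteEdge_of_mem_subtree hG hx u v)

theorem reflTransGen_auxGraphDel_iff (hG : StronglyConnected G) (hr : IsRoot G s r)
    (hu : IsIdom G s u r) {x y : auxVerts G s r} (hx : (x : V) ∈ subtree G s r)
    (hy : (y : V) ∈ subtree G s r) :
    ReflTransGen (auxGraphDel G s r).Adj x y ↔ ReflTransGen (deleteEdge G u r).Adj x y := by
  have hg : IsGate G s r u u r := .inr ⟨hu, rfl, rfl⟩
  rw [hg.reflTransGen_iff hG hr hx hy, ← reflTransGen_coe_iff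
    (R := fun p q : V => AuxAdj G s r p q ∧ ¬ (p = u ∧ q = r)) fun _ _ h => h.1.mem_auxVerts.2]
  have : (auxGraphDel G s r).Adj = fun p q : auxVerts G s r =>
      AuxAdj G s r p q ∧ ¬ ((p : V) = u ∧ (q : V) = r) := by
    funext p q
    have hp : (domTree G s).Adj p r ↔ (p : V) = u := ⟨fun h => h.unique hG hu, fun h => h ▸ hu⟩
    simp only [auxGraphDel, auxGraph, hp, auxRoot, Subtype.ext_iff]
  rw [this]

theorem sameSCC_auxGraphDel_start (hG : StronglyConnected G) (x y : auxVerts G s s) :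
    SameSCC (auxGraphDel G s s) x y := by
  have : (auxGraphDel G s s).Adj = (auxGraph G s s).Adj := by
    funext p q
    have hp : ¬ (domTree G s).Adj p s := fun h =>
      not_dominates_of_isIdom hG h (dominates_start G s p)
    simp [auxGraphDel, hp]
  rw [sameSCC_iff, this]
  exact ⟨reaches_iff.1 (stronglyConnected_auxGraph hG (.inl rfl) x y),
    reaches_iff.1 (stronglyConnected_auxGraph hG (.inl rfl) y x)⟩

/-- If no edge removal prevents `x` and `y` from reaching the start vertex, then the
strongly connected components of `G_r \ (d(r), r)` tell whether they are 2-edge-connected. -/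
theorem sameSCC_auxGraphDel_iff (hG : StronglyConnected G) (hr : IsRoot G s r)
    {x y : auxVerts G s r} (hx : (x : V) ∈ subtree G s r) (hy : (y : V) ∈ subtree G s r)
    (hxs : ∀ a b, ReflTransGen (deleteEdge G a b).Adj x s)
    (hys : ∀ a b, ReflTransGen (deleteEdge G a b).Adj y s) :
    SameSCC (auxGraphDel G s r) x y ↔ TwoEdgeConnected G x y := by
  by_cases hrs : r = s
  -- At the start vertex no edge is deleted, and both sides always hold: `x` and `y` reach each
  -- other through `s`.
  · subst hrs
    refine iff_of_true (sameSCC_auxGraphDel_start hG x y) (twoEdgeConnected_iff.2 fun a b => ?_)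
    exact sameSCC_iff.2
      ⟨(hxs a b).trans (reflTransGen_deleteEdge_of_mem_subtree hG hy a b),
        (hys a b).trans (reflTransGen_deleteEdge_of_mem_subtree hG hx a b)⟩
  obtain ⟨u, hu⟩ := exists_isIdom hG hrs
  rw [sameSCC_iff, reflTransGen_auxGraphDel_iff hG hr hu hx hy,
    reflTransGen_auxGraphDel_iff hG hr hu hy hx, twoEdgeConnected_iff]
  refine ⟨fun h a b => ?_, fun h => sameSCC_iff.1 (h u r)⟩
  have key : ∀ p q : V, p ∈ subtree G s r → q ∈ subtree G s r →
      (∀ a b, ReflTransGen (deleteEdge G a b).Adj p s) →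
      ReflTransGen (deleteEdge G u r).Adj p q → ReflTransGen (deleteEdge G a b).Adj p q := by
    intro p q hp hq hps hpq
    by_cases hsq : ReflTransGen (deleteEdge G a b).Adj s q
    · exact (hps a b).trans hsq
    obtain ⟨hab, hbq⟩ := isBridge_of_not_reflTransGen hG hsq
    rw [mem_subtree_iff hG] at hp hq
    have hbr := hq.2 b ⟨a, hab⟩ hbq
    -- If `b = r`, the deleted edge is $(d(r),r)$ itself. Otherwise the path, lacking that edge,
    -- stays below `r`, while `b` lies strictly above `r`.
    by_cases hb : b = r
    · subst hb
      rwa [(hab.isIdom hG).unique hG hu]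
    · have := reflTransGen_confine (C := {t | ¬ Dominates G s r t}) hpq (fun h => h hp.1)
        (fun h => h hq.1)
        (.inr fun a b hab ha hb => hab.2 ((hr.isBridge hG hu).eq_of_adj hab.1 hb ha))
      refine reflTransGen_of_le this fun c d hcd => ⟨hcd.1.1, ?_⟩
      rintro ⟨rfl, rfl⟩
      exact hcd.2.2 fun hrd => hb (hbr.antisymm hG hrd)
  exact sameSCC_iff.2 ⟨key x y hx hy hxs h.1, key y x hy hx hys h.2⟩

end TwoEdgeConnectivity

/-! ### The output of the algorithm -/

section Output

variable {V : Type*} {G : Digraph V} {s r v : V}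

theorem subset_subtree_of_mem_sccPieces {C : Set V} (hC : C ∈ sccPieces G s r) :
    C ⊆ subtree G s r := by
  rcases hC with ⟨_, rfl⟩ | ⟨_, S, _, rfl⟩
  · exact Set.singleton_subset_iff.2 (mem_subtree_self G s r)
  · exact Set.inter_subset_right

theorem exists_mem_sccPieces (hv : v ∈ subtree G s r) : ∃ C ∈ sccPieces G s r, v ∈ C := by
  by_cases hr : IsLeaf G s r
  · exact ⟨{r}, .inl ⟨hr, rfl⟩, subtree_eq_of_isLeaf hr ▸ hv⟩
  · exact ⟨_, .inr ⟨hr, _, ⟨⟨v, .inl hv⟩, rfl⟩, rfl⟩, ⟨⟨v, .inl hv⟩, sameSCC_refl _ _, rfl⟩, hv⟩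

variable [Finite V]

/-- Robust access to `s` is required only on `O`, since auxiliary vertices of the processed graph
need not have it; the intersection with `O` discards them. -/
theorem sccPieces_inter_eq (hG : StronglyConnected G) (hr : IsRoot G s r) {C O : Set V}
    (hO : ∀ x ∈ O, ∀ a b, ReflTransGen (deleteEdge G a b).Adj x s)
    (hC : C ∈ sccPieces G s r) (hv : v ∈ C) (hvO : v ∈ O) :
    C ∩ O = {w | w ∈ O ∧ TwoEdgeConnected G v w} := by
  have hvr := subset_subtree_of_mem_sccPieces hC hv
  ext w
  constructor
  · rintro ⟨hw, hwO⟩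
    refine ⟨hwO, ?_⟩
    have hwr := subset_subtree_of_mem_sccPieces hC hw
    rcases hC with ⟨_, rfl⟩ | ⟨_, S, ⟨t, rfl⟩, rfl⟩
    · obtain rfl : w = r := hw
      obtain rfl : v = w := hv
      exact twoEdgeConnected_refl G v
    · obtain ⟨⟨v, hv, rfl⟩, -⟩ := hv
      obtain ⟨⟨w, hw, rfl⟩, -⟩ := hw
      exact (sameSCC_auxGraphDel_iff hG hr hvr hwr (hO _ hvO) (hO _ hwO)).1 (hv.symm.trans hw)
  · rintro ⟨hwO, hvw⟩
    refine ⟨?_, hwO⟩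
    have hwr := hvw.mem_subtree hG hr hvr
    rcases hC with ⟨hl, rfl⟩ | ⟨_, S, ⟨t, rfl⟩, rfl⟩
    · rwa [subtree_eq_of_isLeaf hl] at hwr
    · obtain ⟨⟨v, hv, rfl⟩, -⟩ := hv
      refine ⟨⟨⟨w, .inl hwr⟩, hv.trans ?_, rfl⟩, hwr⟩
      exact (sameSCC_auxGraphDel_iff hG hr hvr hwr (hO _ hvO) (hO _ hwO)).2 hvw

/-- Reversal turns robust reachability from `r` into robust reachability of `r`, as the component
test requires, and preserves two-edge-connectivity. -/
theorem mem_processAux_iff (hG : StronglyConnected G) {O B : Set V}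
    (hO : ∀ x ∈ O, ∀ a b, ReflTransGen (deleteEdge G a b).Adj r x) :
    B ∈ processAux G r O ↔ ∃ v ∈ O, B = {w | w ∈ O ∧ TwoEdgeConnected G v w} := by
  have hO' : ∀ x ∈ O, ∀ a b, ReflTransGen (deleteEdge (reverse G) a b).Adj x r :=
    fun x hx a b => (reflTransGen_reverse_deleteEdge G a b x r).2 (hO x hx b a)
  simp only [← twoEdgeConnected_reverse (G := G)]
  constructor
  · rintro ⟨⟨v, hv⟩, q, hq, C, hC, rfl⟩
    exact ⟨v, hv.2, sccPieces_inter_eq hG.reverse hq hO' hC hv.1 hv.2⟩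
  · rintro ⟨v, hv, rfl⟩
    obtain ⟨q, hq, hvq⟩ := exists_root hG.reverse r v
    obtain ⟨C, hC, hvC⟩ := exists_mem_sccPieces hvq
    exact ⟨⟨v, hv, twoEdgeConnected_refl _ v⟩, q, hq, C, hC,
      (sccPieces_inter_eq hG.reverse hq hO' hC hvC hv).symm⟩

theorem mem_fast2ECB_iff (hG : StronglyConnected G) {B : Set V} :
    B ∈ fast2ECB G s ↔ ∃ v, B = {w | TwoEdgeConnected G v w} := by
  have hleaf : ∀ r, IsRoot G s r → IsLeaf G s r → {w | TwoEdgeConnected G r w} = {r} := by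
    intro r hr hl
    refine Set.Subset.antisymm (fun w hw => ?_) (fun w hw => hw ▸ twoEdgeConnected_refl G r)
    exact subtree_eq_of_isLeaf hl ▸ hw.mem_subtree hG hr (mem_subtree_self G s r)
  have hproc : ∀ r, IsRoot G s r → ∀ C, C ∈ processAux (auxGraph G s r) (auxRoot G s r)
      {x | (x : V) ∈ subtree G s r} ↔ ∃ v ∈ {x : auxVerts G s r | (x : V) ∈ subtree G s r},
        C = {w | w ∈ {x : auxVerts G s r | (x : V) ∈ subtree G s r} ∧
          TwoEdgeConnected (auxGraph G s r) v w} := fun r hr C =>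
    mem_processAux_iff (stronglyConnected_auxGraph hG hr)
      fun x hx a b => reflTransGen_deleteEdge_auxRoot hG hr hx a b
  -- A class meeting $T(r)$ is contained in it, so no member is lost by looking only at ordinary
  -- vertices of $G_r$.
  have himage : ∀ r, IsRoot G s r → ∀ v : auxVerts G s r, (v : V) ∈ subtree G s r →
      Subtype.val '' {w : auxVerts G s r | w ∈ {x : auxVerts G s r | (x : V) ∈ subtree G s r} ∧
        TwoEdgeConnected (auxGraph G s r) v w} = {w | TwoEdgeConnected G v w} := by
    intro r hr v hv
    ext w
    constructor
    · rintro ⟨w, ⟨hw, hvw⟩, rfl⟩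
      exact (twoEdgeConnected_auxGraph_iff hG hr hv hw).1 hvw
    · intro hvw
      have hw := TwoEdgeConnected.mem_subtree hG hr hvw hv
      exact ⟨⟨w, .inl hw⟩, ⟨hw, (twoEdgeConnected_auxGraph_iff hG hr hv hw).2 hvw⟩, rfl⟩
  constructor
  · rintro ⟨r, hr, ⟨hl, rfl⟩ | ⟨_, C, hC, rfl⟩⟩
    · exact ⟨r, (hleaf r hr hl).symm⟩
    · obtain ⟨v, hv, rfl⟩ := (hproc r hr C).1 hC
      exact ⟨v, himage r hr v hv⟩
  · rintro ⟨v, rfl⟩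
    obtain ⟨r, hr, hv⟩ := exists_root hG s v
    refine ⟨r, hr, ?_⟩
    by_cases hl : IsLeaf G s r
    · obtain rfl : v = r := by rwa [subtree_eq_of_isLeaf hl] at hv
      exact .inl ⟨hl, hleaf v hr hl⟩
    · exact .inr ⟨hl, _, (hproc r hr _).2 ⟨⟨v, .inl hv⟩, hv, rfl⟩,
        (himage r hr ⟨v, .inl hv⟩ hv).symm⟩

end Output

end TwoECB

theorem mainTheorem2 {V : Type*} [Finite V] (G : Digraph V) (hG : TwoECB.StronglyConnected G)
    (s : V) :
    TwoECB.fast2ECB G s = {B : Set V | TwoECB.IsTwoEdgeConnectedBlock G B} := by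
  have : Nonempty V := ⟨s⟩
  ext B
  exact (TwoECB.mem_fast2ECB_iff hG).trans TwoECB.isTwoEdgeConnectedBlock_iff.symm
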